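/- A solution of the ultradiscrete KdV equation (udKdV) is a family $(U_i^t)_{i,t\in\mathbb Z}$ of real numbers such that for each $t$ only finitely many $U_i^t$ are nonzero and $$U_i^{t+1}=\min\Big(1-U_i^t,\ \sum_{j<i}(U_j^t-U_j^{t+1})\Big)\qquad(i,t\in\mathbb Z).$$ For $\omega>0$ put $\kappa=\min(1,\omega)$ and $c=\max(1,\omega)$. For a finitely supported state $u$ let $V(u)=\max_i(u_i+u_{i+1})$; a finitely supported state with $V=0$ is called a background. **Undressing.** Let $u$ be a finitely supported state with $V(u)>0$ and let $U$ be a solution with $U^0=u$. Put $X_i=\sum_{j\ge i}(U_j^{1}-U_j^{-1})$ and $\omega=\omega_{\max}=\max_i X_i$ (the mass of the heaviest solitons), choose any $m$ with $X_m=\omega$, and put $$\phi=m+\frac1\kappa\Big(\sum_{j\ge m}U_j^{-1}-\sum_{j<m}U_j^0\Big),\qquad \bar\Theta_i^t=\min\Big(\kappa(i-\phi-ct)+\sum_{j\ge i}U_j^t,\ \sum_{j<i}U_j^{t-1}\Big).$$ The corresponding undressing of $u$, which removes one heaviest soliton, with data $(\omega,\phi)$, is the state $$\widehat u_i=U_i^0+\bar\Theta_{i+1}^0+\bar\Theta_i^1-\bar\Theta_i^0-\bar\Theta_{i+1}^1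 .$$ A complete undressing of $u$ is a finite (possibly empty) succession of undressings that starts at $u$ and ends in a background $B$; its data are the pairs $(\omega_1,\phi_1),\dots,(\omega_N,\phi_N)$ in the order in which they are obtained. **Theorem.** Let $U^0=(U_i^0)_{i\in\mathbb Z}$ be any finitely supported real state. 1. $U^0$ has a complete undressing, and no infinite succession of undressings starts at $U^0$, whatever choices are made. 2. Let $(\omega_1,\phi_1),\dots,(\omega_N,\phi_N)$ and $B$ be the data and the background of any complete undressing of $U^0$. Then $\omega_1\ge\omega_2\ge\dots\ge\omega_N>0$. Define $$T_i^{[0],t}=\tfrac12\sum_{j\in\mathbb Z}|i-t-j|\,B_j$$ and, for $k=1,\dots,N$, with $(\omega,\phi)=(\omega_{N+1-k},\phi_{N+1-k})$ and the corresponding $\kappa$ and $c$, Nakata's dressing $$T_i^{[k],t}=\max\Big(\tfrac12\kappa(i-\phi-ct)+T_i^{[k-1],t+1},\ -\tfrac12\kappa(i-\phi-ct)+T_i^{[k-1],t-1}\Big).$$ Then $T=T^{[N]}$ satisfies the ultradiscrete bilinear KdV equation $$T_{i+1}^{t+1}+T_i^{t-1}=\max\big(T_{i+1}^t+T_i^t,\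 T_i^{t+1}+T_{i+1}^{t-1}-1\big)\qquad(i,t\in\mathbb Z),$$ and $U_i^t=T_{i+1}^t+T_i^{t+1}-T_i^t-T_{i+1}^{t+1}$ is a solution of udKdV, finitely supported at every time, that coincides with the given state $U_i^0$ at $t=0$. -/

import Mathlib

namespace UdKdV

noncomputable section

/-! A field is a function `U : ℤ → ℤ → ℝ`; the value of `U` at time `t` and site `i` is `U t i`,
so `U t` is the state at time `t`.  The same convention is used for `T`-functions. -/

/-- A real state on the lattice `ℤ` has finite support. -/
def FiniteSupport (u : ℤ → ℝ) : Prop := (Function.support u).Finite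

/-- `U` solves the ultradiscrete KdV equation: all states have finite support, and the update rule
`U^{t+1}_i = min (1 - U^t_i, ∑_{j<i} (U^t_j - U^{t+1}_j))` holds at all times and sites. -/
def IsSolution (U : ℤ → ℤ → ℝ) : Prop :=
  (∀ t, FiniteSupport (U t)) ∧
    ∀ t i, U (t + 1) i = min (1 - U t i) (∑ᶠ j ∈ Set.Iio i, (U t j - U (t + 1) j))

/-- The maximal local sum `V = max_i (u_i + u_{i+1})`. -/
def maximalLocalSum (u : ℤ → ℝ) : ℝ := ⨆ i : ℤ, (u i + u (i + 1))

/-- A soliton-free state (background, possibly zero): finite support and `V = 0`. -/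
def IsBackground (u : ℤ → ℝ) : Prop := FiniteSupport u ∧ maximalLocalSum u = 0

/-- The conserved density `X^t_i = ∑_{j≥i} (U^{t+1}_j - U^{t-1}_j)`. -/
def X (U : ℤ → ℤ → ℝ) (t i : ℤ) : ℝ := ∑ᶠ j ∈ Set.Ici i, (U (t + 1) j - U (t - 1) j)

/-- The maximal soliton mass `ω_max = max_i X^t_i`. -/
def maxMass (U : ℤ → ℤ → ℝ) (t : ℤ) : ℝ := ⨆ i : ℤ, X U t i

/-- The wave number of a soliton of mass `ω`. -/
def waveNumber (ω : ℝ) : ℝ := min 1 ω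

/-- The speed of a soliton of mass `ω`. -/
def speed (ω : ℝ) : ℝ := max 1 ω

/-- The time-dependent phase `φ + c t` of a soliton with data `(ω, φ)`. -/
def phaseAt (ω φ : ℝ) (t : ℤ) : ℝ := φ + speed ω * t

/-- The phase constant
`φ = m - c t + κ⁻¹ (∑_{j≥m} U^{t-1}_j - ∑_{j<m} U^t_j)` of mass `ω` at the split point `m`. -/
def phaseConstant (U : ℤ → ℤ → ℝ) (ω : ℝ) (t m : ℤ) : ℝ :=
  m - speed ω * t + 1 / waveNumber ω *
    ((∑ᶠ j ∈ Set.Ici m, U (t - 1) j) - ∑ᶠ j ∈ Set.Iio m, U t j)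

/-- The eigenfunction
`min (κ (i - φ - c t) + ∑_{j≥i} U^t_j, ∑_{j<i} U^{t-1}_j)`. -/
def boundState (U : ℤ → ℤ → ℝ) (ω φ : ℝ) (t i : ℤ) : ℝ :=
  min (waveNumber ω * (i - phaseAt ω φ t) + ∑ᶠ j ∈ Set.Ici i, U t j)
    (∑ᶠ j ∈ Set.Iio i, U (t - 1) j)

/-- The ultradiscrete Darboux transformation of the potential `U` by `Θ`. -/
def darboux (U Θ : ℤ → ℤ → ℝ) (t i : ℤ) : ℝ :=
  U t i + Θ t (i + 1) + Θ (t + 1) i - Θ t i - Θ (t + 1) (i + 1)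

/-- `u'` is obtained from the state `u` (at time `0`), which contains a soliton, by an undressing
transformation that removes one heaviest soliton, with data `(ω, φ)`: `U` is the solution through
`u`, `ω` is its maximal soliton mass, `m` is any site where `X^0` attains its maximum, `φ` is the
phase constant at `m`, and `u'` is the Darboux transform by the bound state for `(ω, φ)`. -/
def IsUndressing (u : ℤ → ℝ) (ω φ : ℝ) (u' : ℤ → ℝ) : Prop :=
  ∃ U : ℤ → ℤ → ℝ, IsSolution U ∧ U 0 = u ∧ 0 < maximalLocalSum u ∧ ω = maxMass U 0 ∧
    ∃ m : ℤ, X U 0 m = ω ∧ φ = phaseConstant U ω 0 m ∧ u' = darboux U (boundState U ω φ) 0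

/-- `CompleteUndressing u L B`: starting from `u`, finitely many undressings, with the recorded
data `L = [(ω₁, φ₁), …, (ω_N, φ_N)]` in this order, lead to the background `B`. -/
inductive CompleteUndressing : (ℤ → ℝ) → List (ℝ × ℝ) → (ℤ → ℝ) → Prop
  | done (B : ℤ → ℝ) (hB : IsBackground B) : CompleteUndressing B [] B
  | step (u u' : ℤ → ℝ) (ω φ : ℝ) (L : List (ℝ × ℝ)) (B : ℤ → ℝ)
      (h : IsUndressing u ω φ u') (h' : CompleteUndressing u' L B) :
      CompleteUndressing u ((ω, φ) :: L) B

/-- The background `T`-function `½ ∑_j |i - t - j| B_j`. -/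
def backgroundT (B : ℤ → ℝ) (t i : ℤ) : ℝ :=
  1 / 2 * ∑ᶠ j : ℤ, |((i - t - j : ℤ) : ℝ)| * B j

/-- Nakata's dressing of a `T`-function by a soliton with data `(ω, φ)`. -/
def dress (ω φ : ℝ) (T : ℤ → ℤ → ℝ) (t i : ℤ) : ℝ :=
  max (1 / 2 * waveNumber ω * (i - phaseAt ω φ t) + T (t + 1) i)
    (-(1 / 2 * waveNumber ω * (i - phaseAt ω φ t)) + T (t - 1) i)

/-- The background `T`-function of `B`, dressed with the data in `L`, the last entry of `L` first
and the head of `L` last. -/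
def reconstructedT : List (ℝ × ℝ) → (ℤ → ℝ) → ℤ → ℤ → ℝ
  | [], B => backgroundT B
  | p :: L, B => dress p.1 p.2 (reconstructedT L B)

/-- The field `U^t_i = T^t_{i+1} + T^{t+1}_i - T^t_i - T^{t+1}_{i+1}` of a `T`-function. -/
def potential (T : ℤ → ℤ → ℝ) (t i : ℤ) : ℝ :=
  T t (i + 1) + T (t + 1) i - T t i - T (t + 1) (i + 1)

/-- The ultradiscrete bilinear KdV equation. -/
def IsBilinearSolution (T : ℤ → ℤ → ℝ) : Prop :=
  ∀ t i, T (t + 1) (i + 1) + T (t - 1) i =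
    max (T t (i + 1) + T t i) (T (t + 1) i + T (t - 1) (i + 1) - 1)

end

end UdKdV

namespace UdKdV

/-! Pass to cumulative states `S t i`, the sum of the field over sites left of `i`. The update rule
becomes a complementarity condition, symmetric under space-time reflection, which determines both
the next and the previous state, so the solution through a state exists and is unique. The density
`S (t - 1) i - S (t + 1) i` cannot be lost in time while positive, so its maximum `ω` at time 0
bounds it at all times. The mismatch of the two branches of the bound state is then nonincreasing in
time at each site. A crossing is a time step on which it stays zero; crossings propagate from the
chosen `m` to every site (`crossing_succ`, `crossing_pred`). Undressing thus only cuts two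
consecutive times out of the history of each site. The rule survives (`step_across_crossing`), the
densities stay at most `ω`, and the excised field values have positive sum. Since each site is
active at finitely many times, the number of active times at site 0 strictly drops, whence
termination. Conversely, the maximum in the dressing switches branch exactly at the crossing, so
dressing restores the time differences of `T` (`IsTau.dress`). A background merely translates, and
its `T`-function is explicit. Induction along the undressing then identifies the potential of `T`
with the solution; the bilinear equation is the update rule in these differences. -/

/-- A cumulative state: it vanishes far to the left and equals the total mass far to the right. -/
structure IsProfile (M : ℝ) (g : ℤ → ℝ) : Prop where
  left : ∃ a, ∀ i ≤ a, g i = 0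
  right : ∃ b, ∀ i ≥ b, g i = M

/-- The udKdV update rule in terms of cumulative states. -/
def Step (g g' : ℤ → ℝ) : Prop :=
  ∀ i, min (1 - (g (i + 1) - g i) - (g' (i + 1) - g' i)) (g i - g' (i + 1)) = 0

/-- A family of cumulative states of total mass `M` evolving by the udKdV update rule. -/
structure IsEvolution (S : ℤ → ℤ → ℝ) (M : ℝ) : Prop where
  profile : ∀ t, IsProfile M (S t)
  step : ∀ t, Step (S t) (S (t + 1))

/-- The field whose cumulative states are `S t`. -/
def field (S : ℤ → ℤ → ℝ) (t i : ℤ) : ℝ := S t (i + 1) - S t i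

/-! ### Sums of finitely supported states -/

theorem eq_of_agree_left {g g' : ℤ → ℝ} {a : ℤ} (h : ∀ i ≤ a, g i = g' i)
    (hs : ∀ i, g i = g' i → g (i + 1) = g' (i + 1)) (i : ℤ) : g i = g' i := by
  rcases le_total i a with hi | hi
  · exact h i hi
  · induction i, hi using Int.leInduction with
    | base => exact h a le_rfl
    | succ n _ ih => exact hs n ih

theorem eq_of_agree_right {g g' : ℤ → ℝ} {b : ℤ} (h : ∀ i ≥ b, g i = g' i)
    (hs : ∀ i, g (i + 1) = g' (i + 1) → g i = g' i) (i : ℤ) : g i = g' i := by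
  rcases le_total b i with hi | hi
  · exact h i hi
  · induction i, hi using Int.leInductionDown with
    | base => exact h b le_rfl
    | pred n _ ih => exact hs (n - 1) (by simpa using ih)

theorem FiniteSupport.bounds {u : ℤ → ℝ} (hu : FiniteSupport u) :
    ∃ a b, (∀ i < a, u i = 0) ∧ ∀ i ≥ b, u i = 0 := by
  obtain ⟨a, ha⟩ := hu.bddBelow
  obtain ⟨b, hb⟩ := hu.bddAbove
  refine ⟨a, b + 1, fun i hi => ?_, fun i hi => ?_⟩
  · by_contra h
    exact absurd (ha (show i ∈ Function.support u from h)) (by omega)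
  · by_contra h
    have := hb (show i ∈ Function.support u from h)
    omega

theorem finiteSupport_of_bounds {u : ℤ → ℝ} {a b : ℤ} (ha : ∀ i < a, u i = 0)
    (hb : ∀ i ≥ b, u i = 0) : FiniteSupport u := by
  refine (Set.finite_Ico a b).subset fun i hi => ?_
  constructor
  · by_contra h
    exact hi (ha i (by omega))
  · by_contra h
    exact hi (hb i (by omega))

theorem IsProfile.finiteSupport {M : ℝ} {g u : ℤ → ℝ} (hg : IsProfile M g)
    (hu : ∀ i, u i = g (i + 1) - g i) : FiniteSupport u := by
  obtain ⟨⟨a, ha⟩, b, hb⟩ := hg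
  refine finiteSupport_of_bounds (a := a) (b := b) (fun i hi => ?_) (fun i hi => ?_)
  · rw [hu, ha _ (by omega), ha _ (by omega), sub_zero]
  · rw [hu, hb _ (by omega), hb _ (by omega), sub_self]

theorem FiniteSupport.finsum_Iio_succ {u : ℤ → ℝ} (hu : FiniteSupport u) (i : ℤ) :
    ∑ᶠ j ∈ Set.Iio (i + 1), u j = u i + ∑ᶠ j ∈ Set.Iio i, u j := by
  have : Set.Iio (i + 1) = insert i (Set.Iio i) := by
    ext j; simp only [Set.mem_Iio, Set.mem_insert_iff]; omega
  rw [this, finsum_mem_insert' _ (by simp) (hu.subset Set.inter_subset_right)]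

theorem FiniteSupport.finsum_Ici_eq {u : ℤ → ℝ} (hu : FiniteSupport u) (i : ℤ) :
    ∑ᶠ j ∈ Set.Ici i, u j = u i + ∑ᶠ j ∈ Set.Ici (i + 1), u j := by
  have : Set.Ici i = insert i (Set.Ici (i + 1)) := by
    ext j; simp only [Set.mem_Ici, Set.mem_insert_iff]; omega
  rw [this, finsum_mem_insert' _ (by simp) (hu.subset Set.inter_subset_right)]

theorem finsum_mem_eq_zero_of_forall {u : ℤ → ℝ} {s : Set ℤ} (h : ∀ j ∈ s, u j = 0) :
    ∑ᶠ j ∈ s, u j = 0 := by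
  rw [finsum_mem_congr rfl h, finsum_mem_zero]

theorem IsProfile.finsum_Iio {M : ℝ} {g u : ℤ → ℝ} (hg : IsProfile M g)
    (hu : ∀ i, u i = g (i + 1) - g i) (i : ℤ) : ∑ᶠ j ∈ Set.Iio i, u j = g i := by
  obtain ⟨a, ha⟩ := hg.left
  refine eq_of_agree_left (g := fun i => ∑ᶠ j ∈ Set.Iio i, u j) (a := a) (fun i hi => ?_)
    (fun i hi => ?_) i
  · rw [ha i hi]
    refine finsum_mem_eq_zero_of_forall fun j hj => ?_
    have hj' : j < i := hj
    rw [hu, ha _ (by omega), ha _ (by omega), sub_zero]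
  · rw [(hg.finiteSupport hu).finsum_Iio_succ, hi, hu]
    ring

theorem IsProfile.finsum_Ici {M : ℝ} {g u : ℤ → ℝ} (hg : IsProfile M g)
    (hu : ∀ i, u i = g (i + 1) - g i) (i : ℤ) : ∑ᶠ j ∈ Set.Ici i, u j = M - g i := by
  obtain ⟨b, hb⟩ := hg.right
  refine eq_of_agree_right (g := fun i => ∑ᶠ j ∈ Set.Ici i, u j) (g' := fun i => M - g i) (b := b)
    (fun i hi => ?_) (fun i hi => ?_) i
  · simp only [hb i hi, sub_self]
    refine finsum_mem_eq_zero_of_forall fun j hj => ?_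
    have hj' : i ≤ j := hj
    rw [hu, hb _ (by omega), hb _ (by omega), sub_self]
  · rw [(hg.finiteSupport hu).finsum_Ici_eq, hi, hu]
    ring

theorem FiniteSupport.exists_profile {u : ℤ → ℝ} (hu : FiniteSupport u) :
    ∃ M g, IsProfile M g ∧ ∀ i, u i = g (i + 1) - g i := by
  obtain ⟨a, b, ha, hb⟩ := hu.bounds
  refine ⟨∑ᶠ j ∈ Set.Iio b, u j, fun i => ∑ᶠ j ∈ Set.Iio i, u j, ⟨⟨a, fun i hi => ?_⟩, b,
    fun i hi => ?_⟩, fun i => ?_⟩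
  · exact finsum_mem_eq_zero_of_forall fun j hj => ha j (lt_of_lt_of_le hj hi)
  · induction i, hi using Int.leInduction with
    | base => rfl
    | succ n hn ih =>
      rw [hu.finsum_Iio_succ, ih, hb n hn, zero_add]
  · simp only
    rw [hu.finsum_Iio_succ]
    ring

theorem IsProfile.sub {M M' : ℝ} {g g' : ℤ → ℝ} (h : IsProfile M g) (h' : IsProfile M' g') :
    IsProfile (M - M') fun i => g i - g' i := by
  obtain ⟨⟨a, ha⟩, b, hb⟩ := h
  obtain ⟨⟨a', ha'⟩, b', hb'⟩ := h'
  refine ⟨⟨min a a', fun i hi => ?_⟩, max b b', fun i hi => ?_⟩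
  · simp only [ha i (by omega), ha' i (by omega), sub_zero]
  · simp only [hb i (by omega), hb' i (by omega)]

theorem IsProfile.reflect {M : ℝ} {g : ℤ → ℝ} (h : IsProfile M g) :
    IsProfile M fun i => M - g (1 - i) := by
  obtain ⟨⟨a, ha⟩, b, hb⟩ := h
  refine ⟨⟨1 - b, fun i hi => ?_⟩, 1 - a, fun i hi => ?_⟩
  · simp only [hb (1 - i) (by omega), sub_self]
  · simp only [ha (1 - i) (by omega), sub_zero]

/-! ### The update rule -/

theorem Step.eq_min {g g' : ℤ → ℝ} (h : Step g g') (i : ℤ) :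
    g' (i + 1) = min (1 - (g (i + 1) - g i) + g' i) (g i) := by
  have := h i
  rcases min_cases (1 - (g (i + 1) - g i) - (g' (i + 1) - g' i)) (g i - g' (i + 1)) with h1 | h1
  · rw [min_eq_left (by linarith)]; linarith
  · rw [min_eq_right (by linarith)]; linarith

theorem step_of_eq_min {g g' : ℤ → ℝ}
    (h : ∀ i, g' (i + 1) = min (1 - (g (i + 1) - g i) + g' i) (g i)) : Step g g' := by
  intro i
  rcases min_cases (1 - (g (i + 1) - g i) + g' i) (g i) with h1 | h1
  · rw [min_eq_left] <;> linarith [h i]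
  · rw [min_eq_right] <;> linarith [h i]

theorem Step.eq_max {g g' : ℤ → ℝ} (h : Step g g') (i : ℤ) :
    g i = max (g (i + 1) - 1 + (g' (i + 1) - g' i)) (g' (i + 1)) := by
  have := h i
  rcases min_cases (1 - (g (i + 1) - g i) - (g' (i + 1) - g' i)) (g i - g' (i + 1)) with h1 | h1
  · rw [max_eq_left (by linarith)]; linarith
  · rw [max_eq_right (by linarith)]; linarith

/-- Both arguments of the minimum are invariant under reversing space and exchanging the two states;
backward evolution is thereby forward evolution of the mirror image. -/
theorem Step.reflect {g g' : ℤ → ℝ} (h : Step g g') (M : ℝ) :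
    Step (fun i => M - g' (1 - i)) (fun i => M - g (1 - i)) := by
  intro i
  have := h (-i)
  simp only [show 1 - (i + 1) = -i by ring, show 1 - i = -i + 1 by ring]
  rw [← this]
  congr 1 <;> ring

theorem Step.forward_unique {M M' : ℝ} {g g₁ g₂ : ℤ → ℝ} (h₁ : IsProfile M g₁)
    (h₂ : IsProfile M' g₂) (s₁ : Step g g₁) (s₂ : Step g g₂) : g₁ = g₂ := by
  obtain ⟨a, ha⟩ := h₁.left
  obtain ⟨a', ha'⟩ := h₂.left
  funext i
  refine eq_of_agree_left (a := min a a') (fun i hi => ?_) (fun i hi => ?_) i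
  · rw [ha i (by omega), ha' i (by omega)]
  · rw [s₁.eq_min, s₂.eq_min, hi]

theorem Step.backward_unique {M : ℝ} {g g₁ g₂ : ℤ → ℝ} (h₁ : IsProfile M g₁)
    (h₂ : IsProfile M g₂) (s₁ : Step g₁ g) (s₂ : Step g₂ g) : g₁ = g₂ := by
  obtain ⟨b, hb⟩ := h₁.right
  obtain ⟨b', hb'⟩ := h₂.right
  funext i
  refine eq_of_agree_right (b := max b b') (fun i hi => ?_) (fun i hi => ?_) i
  · rw [hb i (by omega), hb' i (by omega)]
  · rw [s₁.eq_max, s₂.eq_max, hi]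

theorem IsProfile.exists_step {M : ℝ} {g : ℤ → ℝ} (hg : IsProfile M g) :
    ∃ g', IsProfile M g' ∧ Step g g' := by
  obtain ⟨⟨a, ha⟩, b, hb⟩ := hg
  let G : ℕ → ℝ := fun n => Nat.rec 0
    (fun n x => min (1 - (g (a + n + 1) - g (a + n)) + x) (g (a + n))) n
  let g' : ℤ → ℝ := fun i => G (i - a).toNat
  have hl : ∀ i ≤ a, g' i = 0 := fun i hi => by
    change G (i - a).toNat = 0
    rw [Int.toNat_of_nonpos (by omega)]
    rfl
  have hs : ∀ i, g' (i + 1) = min (1 - (g (i + 1) - g i) + g' i) (g i) := by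
    intro i
    rcases lt_or_ge i a with hi | hi
    · rw [hl _ (by omega), hl _ (by omega), ha _ (by omega), ha _ (by omega)]
      norm_num
    · obtain ⟨n, rfl⟩ : ∃ n : ℕ, i = a + n := ⟨(i - a).toNat, by omega⟩
      change G (a + n + 1 - a).toNat = min (_ + G (a + n - a).toNat) _
      rw [show (a + n + 1 - a).toNat = n + 1 by omega, show (a + n - a : ℤ).toNat = n by omega]
  -- Beyond the support of the old state the new cumulative state climbs by 1 per site until it is
  -- capped at `M`.
  have hr : ∀ k : ℕ, g' (b + 1 + k) = min (g' (b + 1) + k) M := by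
    intro k
    induction k with
    | zero =>
      simp only [Nat.cast_zero, add_zero]
      rw [eq_comm, min_eq_left]
      rw [hs, ← hb b le_rfl]
      exact min_le_right _ _
    | succ k ih =>
      rw [Nat.cast_succ, ← add_assoc, hs, hb (b + 1 + k + 1) (by omega), hb (b + 1 + k) (by omega),
        ih, Nat.cast_succ]
      rcases min_cases (g' (b + 1) + k) M with h | h
      · rw [h.1]; congr 1; ring
      · rw [h.1, min_eq_right (by linarith), min_eq_right (by linarith)]
  refine ⟨g', ⟨⟨a, hl⟩, ?_⟩, step_of_eq_min hs⟩
  obtain ⟨n, hn⟩ := exists_nat_ge (M - g' (b + 1))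
  refine ⟨b + 1 + n, fun i hi => ?_⟩
  obtain ⟨k, rfl⟩ : ∃ k : ℕ, i = b + 1 + k := ⟨(i - (b + 1)).toNat, by omega⟩
  have : (n : ℝ) ≤ k := by exact_mod_cast (by omega : n ≤ k)
  rw [hr, min_eq_right (by linarith)]

theorem IsProfile.exists_step_back {M : ℝ} {g : ℤ → ℝ} (hg : IsProfile M g) :
    ∃ g', IsProfile M g' ∧ Step g' g := by
  obtain ⟨k, hk, hs⟩ := hg.reflect.exists_step
  refine ⟨_, hk.reflect, ?_⟩
  simpa using hs.reflect M

theorem IsProfile.exists_evolution {M : ℝ} {g : ℤ → ℝ} (hg : IsProfile M g) :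
    ∃ S, IsEvolution S M ∧ S 0 = g := by
  choose! F hF hFs using fun (g : ℤ → ℝ) (hg : IsProfile M g) => hg.exists_step
  choose! P hP hPs using fun (g : ℤ → ℝ) (hg : IsProfile M g) => hg.exists_step_back
  have h₁ : ∀ n : ℕ, IsProfile M (F^[n] g) := fun n => by
    induction n with
    | zero => exact hg
    | succ n ih => rw [Function.iterate_succ_apply']; exact hF _ ih
  have h₂ : ∀ n : ℕ, IsProfile M (P^[n] g) := fun n => by
    induction n with
    | zero => exact hg
    | succ n ih => rw [Function.iterate_succ_apply']; exact hP _ ih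
  let S : ℤ → ℤ → ℝ := fun t => Int.rec (fun n => F^[n] g) (fun n => P^[n + 1] g) t
  refine ⟨S, ⟨fun t => ?_, fun t => ?_⟩, rfl⟩
  · cases t with
    | ofNat n => exact h₁ n
    | negSucc n => exact h₂ (n + 1)
  · rcases t with n | (_ | n)
    · change Step (F^[n] g) (F^[n + 1] g)
      rw [Function.iterate_succ_apply']
      exact hFs _ (h₁ n)
    · exact hPs _ hg
    · change Step (P^[n + 1 + 1] g) (P^[n + 1] g)
      rw [Function.iterate_succ_apply']
      exact hPs _ (h₂ _)

/-! ### Evolutions and solutions -/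

theorem IsEvolution.isSolution {S : ℤ → ℤ → ℝ} {M : ℝ} (h : IsEvolution S M) :
    IsSolution (field S) := by
  refine ⟨fun t => (h.profile t).finiteSupport fun _ => rfl, fun t i => ?_⟩
  rw [((h.profile t).sub (h.profile (t + 1))).finsum_Iio (fun j => by simp only [field]; ring)]
  have := (h.step t).eq_min i
  simp only [field]
  rw [this, ← min_sub_sub_right]
  congr 1
  ring

theorem IsSolution.exists_evolution {U : ℤ → ℤ → ℝ} (hU : IsSolution U) :
    ∃ S M, IsEvolution S M ∧ U = field S := by
  obtain ⟨hf, hs⟩ := hU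
  choose M S hp hu using fun t => (hf t).exists_profile
  have hs' : ∀ t i, S (t + 1) (i + 1) - S (t + 1) i
      = min (1 - (S t (i + 1) - S t i)) (S t i - S (t + 1) i) := by
    intro t i
    have := hs t i
    rwa [((hp t).sub (hp (t + 1))).finsum_Iio (fun j => by simp only [hu]; ring), hu, hu] at this
  -- Far to the right both states are constant and the rule reads `0 = min 1 (M t - M (t + 1))`.
  have hM : ∀ t, M (t + 1) = M t := by
    intro t
    obtain ⟨b, hb⟩ := (hp t).right
    obtain ⟨b', hb'⟩ := (hp (t + 1)).right
    have := hs' t (max b b')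
    rw [hb _ (by omega), hb _ (by omega), hb' _ (by omega), hb' _ (by omega)] at this
    rcases min_cases (1 - (M t - M t)) (M t - M (t + 1)) with h | h <;> linarith
  have hM0 : ∀ t, M t = M 0 := by
    intro t
    induction t with
    | zero => rfl
    | succ n ih => rw [hM, ih]
    | pred n ih => rw [← hM, sub_add_cancel, ih]
  refine ⟨S, M 0, ⟨fun t => hM0 t ▸ hp t, fun t => step_of_eq_min fun i => ?_⟩, ?_⟩
  · have := hs' t i
    rw [sub_eq_iff_eq_add, ← min_add_add_right] at this
    rw [this]
    congr 1
    ring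
  · funext t i
    exact hu t i

theorem IsProfile.eq_of_increments {M M' : ℝ} {g g' : ℤ → ℝ} (h : IsProfile M g)
    (h' : IsProfile M' g') (hu : ∀ i, g (i + 1) - g i = g' (i + 1) - g' i) : g = g' := by
  funext i
  rw [← h.finsum_Iio (fun _ => rfl) i, ← h'.finsum_Iio (fun _ => rfl) i]
  exact finsum_mem_congr rfl fun j _ => hu j

theorem IsProfile.mass_unique {M M' : ℝ} {g : ℤ → ℝ} (h : IsProfile M g)
    (h' : IsProfile M' g) : M = M' := by
  obtain ⟨b, hb⟩ := h.right
  obtain ⟨b', hb'⟩ := h'.right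
  rw [← hb (max b b') (by omega), hb' _ (by omega)]

theorem IsEvolution.unique {S S' : ℤ → ℤ → ℝ} {M M' : ℝ} (h : IsEvolution S M)
    (h' : IsEvolution S' M') (h0 : field S 0 = field S' 0) : S = S' ∧ M = M' := by
  have e0 : S 0 = S' 0 := (h.profile 0).eq_of_increments (h'.profile 0) (congrFun h0)
  obtain rfl : M = M' := (h.profile 0).mass_unique (e0 ▸ h'.profile 0)
  refine ⟨funext fun t => ?_, rfl⟩
  induction t with
  | zero => exact e0
  | succ n ih =>
    exact (h.step n).forward_unique (h.profile _) (h'.profile _) (ih ▸ h'.step n)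
  | pred n ih =>
    have h1 := h.step (-n - 1)
    have h2 := h'.step (-n - 1)
    rw [sub_add_cancel] at h1 h2
    exact h1.backward_unique (h.profile _) (h'.profile _) (ih ▸ h2)

theorem IsEvolution.reflect {S : ℤ → ℤ → ℝ} {M : ℝ} (h : IsEvolution S M) :
    IsEvolution (fun t i => M - S (-t) (1 - i)) M := by
  refine ⟨fun t => (h.profile _).reflect, fun t => ?_⟩
  have := (h.step (-(t + 1))).reflect M
  rwa [show -(t + 1) + 1 = -t by ring] at this

/-! ### Behaviour at a fixed site for large times -/

theorem IsEvolution.exists_eq_zero_of_ge {S : ℤ → ℤ → ℝ} {M : ℝ} (h : IsEvolution S M) (i : ℤ) :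
    ∃ τ, ∀ t ≥ τ, S t i = 0 := by
  obtain ⟨a, ha⟩ := (h.profile 0).left
  have h0 : ∀ t ≥ 0, ∀ i ≤ a, S t i = 0 := by
    intro t ht
    induction t, ht using Int.leInduction with
    | base => exact ha
    | succ t ht ih =>
      obtain ⟨a', ha'⟩ := (h.profile (t + 1)).left
      intro i hi
      rcases le_total i a' with hi' | hi'
      · exact ha' i hi'
      · induction i, hi' using Int.leInduction with
        | base => exact ha' a' le_rfl
        | succ j hj ihj =>
          rw [(h.step t).eq_min, ihj (by omega), ih _ hi, ih j (by omega)]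
          norm_num
  rcases le_total i a with hi | hi
  · exact ⟨0, fun t ht => h0 t ht i hi⟩
  · induction i, hi using Int.leInduction with
    | base => exact ⟨0, fun t ht => h0 t ht a le_rfl⟩
    | succ j hj ih =>
      obtain ⟨τ, hτ⟩ := ih
      have key : ∀ t ≥ τ, S (t + 1) (j + 1) = min (1 - S t (j + 1)) 0 := fun t ht => by
        rw [(h.step t).eq_min, hτ t ht, hτ (t + 1) (by omega)]
        simp
      -- One step makes the value nonpositive; then `1 - S` is at least 1 and the next step gives
      -- exactly zero.
      refine ⟨τ + 2, fun t ht => ?_⟩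
      have h1 := key (t - 1) (by omega)
      have h2 := key (t - 1 - 1) (by omega)
      rw [sub_add_cancel] at h1 h2
      have h3 := min_le_right (1 - S (t - 1 - 1) (j + 1)) 0
      rw [h1, min_eq_right (by linarith)]

theorem IsEvolution.exists_eq_mass_of_le {S : ℤ → ℤ → ℝ} {M : ℝ} (h : IsEvolution S M) (i : ℤ) :
    ∃ τ, ∀ t ≤ τ, S t i = M := by
  obtain ⟨τ, hτ⟩ := h.reflect.exists_eq_zero_of_ge (1 - i)
  refine ⟨-τ, fun t ht => ?_⟩
  have := hτ (-t) (by omega)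
  simp only [neg_neg, sub_sub_cancel] at this
  linarith

theorem IsEvolution.finite_times {S : ℤ → ℤ → ℝ} {M : ℝ} (h : IsEvolution S M) (i : ℤ) :
    FiniteSupport fun t => field S t i := by
  obtain ⟨a, ha⟩ := h.exists_eq_mass_of_le i
  obtain ⟨a', ha'⟩ := h.exists_eq_mass_of_le (i + 1)
  obtain ⟨b, hb⟩ := h.exists_eq_zero_of_ge i
  obtain ⟨b', hb'⟩ := h.exists_eq_zero_of_ge (i + 1)
  refine finiteSupport_of_bounds (a := min a a') (b := max b b') (fun t ht => ?_) fun t ht => ?_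
  · simp only [field, ha t (by omega), ha' t (by omega), sub_self]
  · simp only [field, hb t (by omega), hb' t (by omega), sub_self]

/-! ### The conserved density -/

/-- The density `X` in terms of cumulative states. -/
def density (S : ℤ → ℤ → ℝ) (t i : ℤ) : ℝ := S (t - 1) i - S (t + 1) i

theorem IsEvolution.X_field {S : ℤ → ℤ → ℝ} {M : ℝ} (h : IsEvolution S M) (t i : ℤ) :
    X (field S) t i = density S t i := by
  rw [X, ((h.profile (t + 1)).sub (h.profile (t - 1))).finsum_Ici
    (fun j => by simp only [field]; ring), density]
  ring

theorem IsEvolution.density_profile {S : ℤ → ℤ → ℝ} {M : ℝ} (h : IsEvolution S M) (t : ℤ) :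
    IsProfile 0 (density S t) := by
  have := (h.profile (t - 1)).sub (h.profile (t + 1))
  rwa [sub_self] at this

/-- The complementary pair of nonnegative quantities in the update rule. -/
theorem IsEvolution.complementary {S : ℤ → ℤ → ℝ} {M : ℝ} (h : IsEvolution S M) (t i : ℤ) :
    (0 ≤ 1 - field S t i - field S (t + 1) i ∧ S t i - S (t + 1) (i + 1) = 0) ∨
      (1 - field S t i - field S (t + 1) i = 0 ∧ 0 ≤ S t i - S (t + 1) (i + 1)) := by
  have := h.step t i
  simp only [field]
  rcases min_cases (1 - (S t (i + 1) - S t i) - (S (t + 1) (i + 1) - S (t + 1) i))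
    (S t i - S (t + 1) (i + 1)) with h1 | h1
  · exact Or.inr ⟨by linarith, by linarith⟩
  · exact Or.inl ⟨by linarith, by linarith⟩

/-- A large density at a site is passed on to the next site, at the same or at the next time. -/
theorem IsEvolution.density_succ {S : ℤ → ℤ → ℝ} {M : ℝ} (h : IsEvolution S M) (t i : ℤ) :
    density S t i ≤ density S t (i + 1) ∨ density S t i ≤ density S (t + 1) (i + 1) := by
  have h1 := h.complementary (t - 1) i
  have h2 := h.complementary t i
  have h3 := h.complementary (t + 1) i
  simp only [density, field, sub_add_cancel, add_sub_cancel_right] at *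
  -- If `S (t - 1) i = S t (i + 1)`, the density moves on to the next time; otherwise the fields at
  -- `t - 1` and `t` sum to 1, so the field at `t - 1` is at least that at `t + 1` and the density
  -- grows along the row.
  rcases h1 with h1 | h1
  · right
    rcases h2 with h2 | h2 <;> rcases h3 with h3 | h3 <;>
      linarith [h1.1, h1.2, h2.1, h2.2, h3.1, h3.2]
  · left
    rcases h2 with h2 | h2 <;> linarith [h1.1, h1.2, h2.1, h2.2]

theorem IsEvolution.density_pred {S : ℤ → ℤ → ℝ} {M : ℝ} (h : IsEvolution S M) (t i : ℤ) :
    density S t (i + 1) ≤ density S t i ∨ density S t (i + 1) ≤ density S (t - 1) i := by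
  have h1 := h.complementary (t - 1 - 1) i
  have h2 := h.complementary (t - 1) i
  have h3 := h.complementary t i
  simp only [density, field, sub_add_cancel] at *
  rcases h3 with h3 | h3
  · right
    rcases h2 with h2 | h2 <;> rcases h1 with h1 | h1 <;>
      linarith [h1.1, h1.2, h2.1, h2.2, h3.1, h3.2]
  · left
    rcases h2 with h2 | h2 <;> linarith [h3.1, h3.2, h2.1, h2.2]

/-- Otherwise the density would stay at least `x > 0` all the way to the right, where it vanishes.
-/
theorem IsEvolution.exists_density_ge_succ {S : ℤ → ℤ → ℝ} {M x : ℝ} (h : IsEvolution S M)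
    (hx : 0 < x) {t i : ℤ} (hi : x ≤ density S t i) : ∃ j, x ≤ density S (t + 1) j := by
  by_contra! hcon
  have key : ∀ j ≥ i, x ≤ density S t j := by
    intro j hj
    induction j, hj using Int.leInduction with
    | base => exact hi
    | succ j _ ih =>
      rcases h.density_succ t j with h1 | h1
      · exact ih.trans h1
      · exact absurd (ih.trans h1) (not_le.2 (hcon _))
  obtain ⟨b, hb⟩ := (h.density_profile t).right
  have := key (max i b) (by omega)
  rw [hb _ (by omega)] at this
  linarith

theorem IsEvolution.exists_density_ge_pred {S : ℤ → ℤ → ℝ} {M x : ℝ} (h : IsEvolution S M)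
    (hx : 0 < x) {t i : ℤ} (hi : x ≤ density S t i) : ∃ j, x ≤ density S (t - 1) j := by
  by_contra! hcon
  have key : ∀ j ≤ i, x ≤ density S t j := by
    intro j hj
    induction j, hj using Int.leInductionDown with
    | base => exact hi
    | pred j _ ih =>
      have h1 := h.density_pred t (j - 1)
      rw [sub_add_cancel] at h1
      rcases h1 with h1 | h1
      · exact ih.trans h1
      · exact absurd (ih.trans h1) (not_le.2 (hcon _))
  obtain ⟨a, ha⟩ := (h.density_profile t).left
  have := key (min i a) (by omega)
  rw [ha _ (by omega)] at this
  linarith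

/-- A positive bound on the density at time `0` persists at all times. -/
theorem IsEvolution.density_le {S : ℤ → ℤ → ℝ} {M ω : ℝ} (h : IsEvolution S M) (hω : 0 < ω)
    (h0 : ∀ i, density S 0 i ≤ ω) (t i : ℤ) : density S t i ≤ ω := by
  by_contra! hcon
  set x := density S t i with hx
  have up : ∀ n : ℕ, ∀ s j, x ≤ density S s j → ∃ k, x ≤ density S (s + n) k := by
    intro n s j hj
    induction n with
    | zero => exact ⟨j, by simpa using hj⟩
    | succ n ih =>
      obtain ⟨k, hk⟩ := ih
      simpa [add_assoc] using h.exists_density_ge_succ (hω.trans hcon) hk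
  have down : ∀ n : ℕ, ∀ s j, x ≤ density S s j → ∃ k, x ≤ density S (s - n) k := by
    intro n s j hj
    induction n with
    | zero => exact ⟨j, by simpa using hj⟩
    | succ n ih =>
      obtain ⟨k, hk⟩ := ih
      simpa [sub_sub] using h.exists_density_ge_pred (hω.trans hcon) hk
  obtain ⟨k, hk⟩ : ∃ k, x ≤ density S 0 k := by
    rcases le_total t 0 with ht | ht
    · obtain ⟨k, hk⟩ := up t.natAbs t i le_rfl
      rw [show t + (t.natAbs : ℤ) = 0 by omega] at hk
      exact ⟨k, hk⟩
    · obtain ⟨k, hk⟩ := down t.natAbs t i le_rfl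
      rw [show t - (t.natAbs : ℤ) = 0 by omega] at hk
      exact ⟨k, hk⟩
  linarith [h0 k]

/-- This makes the maximal mass positive as soon as `V > 0`. -/
theorem IsEvolution.local_sum_le_density {S : ℤ → ℤ → ℝ} {M : ℝ} (h : IsEvolution S M) (i : ℤ) :
    field S 0 i + field S 0 (i + 1) ≤ density S 0 (i + 1) := by
  have h1 := h.complementary (0 - 1) (i + 1)
  have h2 := h.complementary 0 i
  simp only [density, field, sub_add_cancel] at *
  rcases h1 with h1 | h1 <;> rcases h2 with h2 | h2 <;> linarith [h1.1, h1.2, h2.1, h2.2]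

/-! ### Suprema of finitely supported functions -/

theorem FiniteSupport.finite_range {u : ℤ → ℝ} (hu : FiniteSupport u) : (Set.range u).Finite :=
  ((hu.image u).insert 0).subset (by
    rintro _ ⟨i, rfl⟩
    by_cases hi : u i = 0
    · exact Or.inl hi
    · exact Or.inr ⟨i, hi, rfl⟩)

theorem IsProfile.finite_range {g : ℤ → ℝ} (hg : IsProfile 0 g) : (Set.range g).Finite := by
  obtain ⟨⟨a, ha⟩, b, hb⟩ := hg
  exact (finiteSupport_of_bounds (fun i hi => ha i hi.le) hb).finite_range

theorem FiniteSupport.local_sum {u : ℤ → ℝ} (hu : FiniteSupport u) :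
    FiniteSupport fun i => u i + u (i + 1) := by
  obtain ⟨a, b, ha, hb⟩ := hu.bounds
  refine finiteSupport_of_bounds (a := a - 1) (b := b) (fun i hi => ?_) fun i hi => ?_
  · simp only [ha i (by omega), ha (i + 1) (by omega), add_zero]
  · simp only [hb i (by omega), hb (i + 1) (by omega), add_zero]

theorem FiniteSupport.local_sum_le {u : ℤ → ℝ} (hu : FiniteSupport u) (i : ℤ) :
    u i + u (i + 1) ≤ maximalLocalSum u :=
  le_ciSup hu.local_sum.finite_range.bddAbove i

theorem FiniteSupport.maximalLocalSum_nonneg {u : ℤ → ℝ} (hu : FiniteSupport u) :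
    0 ≤ maximalLocalSum u := by
  obtain ⟨a, b, ha, hb⟩ := hu.bounds
  have := hu.local_sum_le b
  rwa [hb b le_rfl, hb (b + 1) (by omega), add_zero] at this

theorem IsEvolution.density_le_maxMass {S : ℤ → ℤ → ℝ} {M : ℝ} (h : IsEvolution S M) (t i : ℤ) :
    density S t i ≤ maxMass (field S) t := by
  have : maxMass (field S) t = ⨆ i, density S t i := by simp only [maxMass, h.X_field]
  rw [this]
  exact le_ciSup (h.density_profile t).finite_range.bddAbove i

theorem IsEvolution.exists_density_eq_maxMass {S : ℤ → ℤ → ℝ} {M : ℝ} (h : IsEvolution S M)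
    (t : ℤ) : ∃ i, density S t i = maxMass (field S) t := by
  have : maxMass (field S) t = ⨆ i, density S t i := by simp only [maxMass, h.X_field]
  rw [this]
  exact (Set.range_nonempty _).csSup_mem (h.density_profile t).finite_range

theorem IsEvolution.maximalLocalSum_le_maxMass {S : ℤ → ℤ → ℝ} {M : ℝ} (h : IsEvolution S M) :
    maximalLocalSum (field S 0) ≤ maxMass (field S) 0 :=
  ciSup_le fun i => (h.local_sum_le_density i).trans (h.density_le_maxMass 0 _)

/-! ### Crossing times of a heaviest soliton -/

theorem waveNumber_mul_speed (ω : ℝ) : waveNumber ω * speed ω = ω := by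
  simp [waveNumber, speed, min_mul_max]

theorem waveNumber_pos {ω : ℝ} (h : 0 < ω) : 0 < waveNumber ω := lt_min one_pos h

/-- The difference of the two branches of the bound state with data `(ω, φ)`. -/
def mismatch (S : ℤ → ℤ → ℝ) (M ω φ : ℝ) (t i : ℤ) : ℝ :=
  waveNumber ω * (i - phaseAt ω φ t) + M - S t i - S (t - 1) i

/-- The soliton with data `(ω, φ)` crosses the site `i` between the times `t` and `t + 1`. -/
def IsCrossing (S : ℤ → ℤ → ℝ) (M ω φ : ℝ) (t i : ℤ) : Prop :=
  mismatch S M ω φ t i = 0 ∧ mismatch S M ω φ (t + 1) i = 0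

/-- Because `κ c = ω`, the mismatch is nonincreasing in time when densities are at most `ω`, and
stationary exactly where the density equals `ω`. -/
theorem mismatch_time_succ (S : ℤ → ℤ → ℝ) (M ω φ : ℝ) (t i : ℤ) :
    mismatch S M ω φ (t + 1) i = mismatch S M ω φ t i - ω + density S t i := by
  have := waveNumber_mul_speed ω
  simp only [mismatch, density, phaseAt, add_sub_cancel_right]
  push_cast
  linear_combination -this

theorem mismatch_site_succ (S : ℤ → ℤ → ℝ) (M ω φ : ℝ) (t i : ℤ) :
    mismatch S M ω φ t (i + 1)
      = mismatch S M ω φ t i + waveNumber ω - field S t i - field S (t - 1) i := by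
  simp only [mismatch, field]
  push_cast
  ring

theorem isCrossing_iff {S : ℤ → ℤ → ℝ} {M ω φ : ℝ} {t i : ℤ} :
    IsCrossing S M ω φ t i ↔ mismatch S M ω φ t i = 0 ∧ density S t i = ω := by
  rw [IsCrossing, mismatch_time_succ]
  constructor <;> rintro ⟨h1, h2⟩ <;> exact ⟨h1, by linarith⟩

/-- Maximality of `ω` forces equality in `density_succ`. If the crossing time increases, `ω` is the
sum of the fields at `t` and `t + 1` plus the slack `S t i - S (t + 1) (i + 1)`; complementarity
makes that sum `min 1 ω = κ`, so the mismatch stays zero. If the fields at `t - 1` and `t` sum to 1,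
then `ω ≥ 1` and again `κ` is their sum. -/
theorem IsEvolution.crossing_succ {S : ℤ → ℤ → ℝ} {M ω φ : ℝ} (h : IsEvolution S M)
    (hmax : ∀ t i, density S t i ≤ ω) {t i : ℤ} (hc : IsCrossing S M ω φ t i) :
    IsCrossing S M ω φ t (i + 1) ∨ IsCrossing S M ω φ (t + 1) (i + 1) := by
  have hd := (isCrossing_iff.1 hc).2
  have h1 := h.complementary (t - 1) i
  have h2 := h.complementary t i
  have m1 := hmax t (i + 1)
  have m2 := hmax (t + 1) (i + 1)
  have e1 := mismatch_site_succ S M ω φ t i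
  have e2 := mismatch_site_succ S M ω φ (t + 1) i
  obtain ⟨c1, c2⟩ := hc
  rw [c1] at e1
  rw [c2] at e2
  rw [isCrossing_iff, isCrossing_iff, e1, e2]
  have h3 := h.complementary (t + 1) i
  simp only [density, field, sub_add_cancel, add_sub_cancel_right] at *
  rcases min_cases 1 ω with hw | hw <;> rw [waveNumber, hw.1] <;>
  rcases h1 with h1 | h1 <;> rcases h2 with h2 | h2 <;> rcases h3 with h3 | h3 <;>
  first
    | (right; constructor <;> linarith [h1.1, h1.2, h2.1, h2.2, h3.1, h3.2, hw.2])
    | (left; constructor <;> linarith [h1.1, h1.2, h2.1, h2.2, h3.1, h3.2, hw.2])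

/-- The mirror image of `crossing_succ` under space-time reflection. -/
theorem IsEvolution.crossing_pred {S : ℤ → ℤ → ℝ} {M ω φ : ℝ} (h : IsEvolution S M)
    (hmax : ∀ t i, density S t i ≤ ω) {t i : ℤ} (hc : IsCrossing S M ω φ t (i + 1)) :
    IsCrossing S M ω φ t i ∨ IsCrossing S M ω φ (t - 1) i := by
  have hd := (isCrossing_iff.1 hc).2
  have h1 := h.complementary (t - 1) i
  have h2 := h.complementary t i
  have h3 := h.complementary (t - 1 - 1) i
  have m1 := hmax t i
  have m2 := hmax (t - 1) i
  have e1 := mismatch_site_succ S M ω φ t i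
  have e2 := mismatch_time_succ S M ω φ (t - 1) i
  rw [hc.1] at e1
  rw [isCrossing_iff, isCrossing_iff]
  simp only [density, field, sub_add_cancel] at *
  rcases min_cases 1 ω with hw | hw <;> rw [waveNumber, hw.1] at e1 <;>
  rcases h1 with h1 | h1 <;> rcases h2 with h2 | h2 <;> rcases h3 with h3 | h3 <;>
  first
    | (right; constructor <;> linarith [h1.1, h1.2, h2.1, h2.2, h3.1, h3.2, hw.2])
    | (left; constructor <;> linarith [h1.1, h1.2, h2.1, h2.2, h3.1, h3.2, hw.2])

theorem IsEvolution.exists_crossing {S : ℤ → ℤ → ℝ} {M ω φ : ℝ} (h : IsEvolution S M)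
    (hmax : ∀ t i, density S t i ≤ ω) {s m : ℤ} (hc : IsCrossing S M ω φ s m) (i : ℤ) :
    ∃ t, IsCrossing S M ω φ t i := by
  rcases le_total m i with hi | hi
  · induction i, hi using Int.leInduction with
    | base => exact ⟨s, hc⟩
    | succ i _ ih =>
      obtain ⟨t, ht⟩ := ih
      rcases h.crossing_succ hmax ht with h1 | h1 <;> exact ⟨_, h1⟩
  · induction i, hi using Int.leInductionDown with
    | base => exact ⟨s, hc⟩
    | pred i _ ih =>
      obtain ⟨t, ht⟩ := ih
      rw [← sub_add_cancel i 1] at ht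
      rcases h.crossing_pred hmax ht with h1 | h1 <;> exact ⟨_, h1⟩

theorem mismatch_nonneg {S : ℤ → ℤ → ℝ} {M ω φ : ℝ} (hmax : ∀ t i, density S t i ≤ ω) {s i : ℤ}
    (hc : IsCrossing S M ω φ s i) {t : ℤ} (ht : t ≤ s + 1) : 0 ≤ mismatch S M ω φ t i := by
  induction t, ht using Int.leInductionDown with
  | base => exact hc.2.ge
  | pred t _ ih =>
    have := mismatch_time_succ S M ω φ (t - 1) i
    rw [sub_add_cancel] at this
    linarith [hmax (t - 1) i]

theorem mismatch_nonpos {S : ℤ → ℤ → ℝ} {M ω φ : ℝ} (hmax : ∀ t i, density S t i ≤ ω) {s i : ℤ}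
    (hc : IsCrossing S M ω φ s i) {t : ℤ} (ht : s ≤ t) : mismatch S M ω φ t i ≤ 0 := by
  induction t, ht using Int.leInduction with
  | base => exact hc.1.le
  | succ t _ ih =>
    rw [mismatch_time_succ]
    linarith [hmax t i]

/-! ### Undressing -/

/-- The cumulative states after removing the soliton with data `(ω, φ)`. -/
def undressed (S : ℤ → ℤ → ℝ) (M ω φ : ℝ) (t i : ℤ) : ℝ :=
  S (t - 1) i - ω + min (mismatch S M ω φ t i) 0 - min (mismatch S M ω φ (t + 1) i) 0

theorem IsEvolution.boundState_eq {S : ℤ → ℤ → ℝ} {M : ℝ} (h : IsEvolution S M) (ω φ : ℝ)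
    (t i : ℤ) :
    boundState (field S) ω φ t i = S (t - 1) i + min (mismatch S M ω φ t i) 0 := by
  rw [boundState, (h.profile t).finsum_Ici (u := field S t) (fun _ => rfl),
    (h.profile (t - 1)).finsum_Iio (u := field S (t - 1)) (fun _ => rfl), ← min_add_add_left,
    add_zero, mismatch]
  congr 1
  ring

/-- The constant `-ω` in `undressed` drops out of the field; it makes the cumulative states vanish
far to the left. -/
theorem IsEvolution.darboux_eq {S : ℤ → ℤ → ℝ} {M : ℝ} (h : IsEvolution S M) (ω φ : ℝ) :
    darboux (field S) (boundState (field S) ω φ) = field (undressed S M ω φ) := by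
  funext t i
  simp only [darboux, h.boundState_eq, field, undressed, add_sub_cancel_right]
  ring

section Crossing

variable {S : ℤ → ℤ → ℝ} {M ω φ : ℝ}

/-- Before the crossing both minima are zero, after it both equal the mismatch. The two resulting
formulas agree at `t = s`, since the density there is `ω`. -/
theorem undressed_of_le (hmax : ∀ t i, density S t i ≤ ω) {s i : ℤ}
    (hc : IsCrossing S M ω φ s i) {t : ℤ} (ht : t ≤ s) :
    undressed S M ω φ t i = S (t - 1) i - ω := by
  rw [undressed, min_eq_right (mismatch_nonneg hmax hc (by omega)),
    min_eq_right (mismatch_nonneg hmax hc (by omega))]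
  ring

theorem undressed_of_ge (hmax : ∀ t i, density S t i ≤ ω) {s i : ℤ}
    (hc : IsCrossing S M ω φ s i) {t : ℤ} (ht : s ≤ t) :
    undressed S M ω φ t i = S (t + 1) i := by
  rw [undressed, min_eq_left (mismatch_nonpos hmax hc ht),
    min_eq_left (mismatch_nonpos hmax hc (by omega)), mismatch_time_succ, density]
  ring

theorem IsEvolution.undressed_profile (h : IsEvolution S M) (hω : 0 < ω) (t : ℤ) :
    IsProfile (M - ω) (undressed S M ω φ t) := by
  have hκ := waveNumber_pos hω
  -- Far out the cumulative states are constant and the linear term decides the sign of the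
  -- mismatch.
  have low : ∀ t, ∃ a : ℤ, ∀ i ≤ a, mismatch S M ω φ t i ≤ 0 := by
    intro t
    obtain ⟨a₁, h₁⟩ := (h.profile t).left
    obtain ⟨a₂, h₂⟩ := (h.profile (t - 1)).left
    obtain ⟨a₃, h₃⟩ := exists_int_lt (phaseAt ω φ t - M / waveNumber ω)
    refine ⟨min a₁ (min a₂ a₃), fun i hi => ?_⟩
    have hi' : (i : ℝ) ≤ a₃ := by exact_mod_cast (by omega : i ≤ a₃)
    have : waveNumber ω * (i - phaseAt ω φ t) ≤ waveNumber ω * (-(M / waveNumber ω)) :=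
      mul_le_mul_of_nonneg_left (by linarith) hκ.le
    rw [mul_neg, mul_div_cancel₀ _ hκ.ne'] at this
    rw [mismatch, h₁ i (by omega), h₂ i (by omega)]
    linarith
  have high : ∀ t, ∃ b : ℤ, ∀ i ≥ b, 0 ≤ mismatch S M ω φ t i := by
    intro t
    obtain ⟨b₁, h₁⟩ := (h.profile t).right
    obtain ⟨b₂, h₂⟩ := (h.profile (t - 1)).right
    obtain ⟨b₃, h₃⟩ := exists_int_gt (phaseAt ω φ t + M / waveNumber ω)
    refine ⟨max b₁ (max b₂ b₃), fun i hi => ?_⟩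
    have hi' : (b₃ : ℝ) ≤ i := by exact_mod_cast (by omega : b₃ ≤ i)
    have : waveNumber ω * (M / waveNumber ω) ≤ waveNumber ω * (i - phaseAt ω φ t) :=
      mul_le_mul_of_nonneg_left (by linarith) hκ.le
    rw [mul_div_cancel₀ _ hκ.ne'] at this
    rw [mismatch, h₁ i (by omega), h₂ i (by omega)]
    linarith
  constructor
  · obtain ⟨a₁, h₁⟩ := low t
    obtain ⟨a₂, h₂⟩ := low (t + 1)
    obtain ⟨a₃, h₃⟩ := (h.profile (t + 1)).left
    refine ⟨min a₁ (min a₂ a₃), fun i hi => ?_⟩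
    rw [undressed, min_eq_left (h₁ i (by omega)), min_eq_left (h₂ i (by omega)),
      mismatch_time_succ, density, h₃ i (by omega)]
    ring
  · obtain ⟨b₁, h₁⟩ := high t
    obtain ⟨b₂, h₂⟩ := high (t + 1)
    obtain ⟨b₃, h₃⟩ := (h.profile (t - 1)).right
    refine ⟨max b₁ (max b₂ b₃), fun i hi => ?_⟩
    rw [undressed, min_eq_right (h₁ i (by omega)), min_eq_right (h₂ i (by omega)),
      h₃ i (by omega)]
    ring

/-- Where the crossing time increases from one site to the next, the two states adjacent to the
excised ones are again related by the update rule. -/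
theorem IsEvolution.step_across_crossing (h : IsEvolution S M)
    (hmax : ∀ t i, density S t i ≤ ω) {s i : ℤ} (hc : IsCrossing S M ω φ s i)
    (hc' : IsCrossing S M ω φ (s + 1) (i + 1)) :
    min (1 - (S (s - 1) (i + 1) - ω - (S (s - 1) i - ω)) -
        (S (s + 1 + 1) (i + 1) - S (s + 1 + 1) i))
      (S (s - 1) i - ω - S (s + 1 + 1) (i + 1)) = 0 := by
  have d1 := (isCrossing_iff.1 hc).2
  have d2 := (isCrossing_iff.1 hc').2
  -- The bounds beside the crossing say that, at site `i`, the field at `s - 1` is at most that at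
  -- `s + 1`, and the field at `s + 2` at most that at `s`; this controls the newly adjacent pair.
  have m1 := hmax s (i + 1)
  have m2 := hmax (s + 1) i
  have h1 := h.complementary (s - 1) i
  have h2 := h.complementary s i
  have h3 := h.complementary (s + 1) i
  simp only [density, field, sub_add_cancel, add_sub_cancel_right] at *
  rcases h1 with h1 | h1 <;> rcases h2 with h2 | h2 <;> rcases h3 with h3 | h3 <;>
  first
    | (rw [min_eq_right] <;> linarith [h1.1, h1.2, h2.1, h2.2, h3.1, h3.2])
    | (rw [min_eq_left] <;> linarith [h1.1, h1.2, h2.1, h2.2, h3.1, h3.2])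

/-- Away from the crossing, neighbouring sites are shifted in time alike and inherit the rule of
`S`. Only when the crossing time increases by one does a new pair of states meet, at `t = s`. -/
theorem IsEvolution.undressed (h : IsEvolution S M) (hω : 0 < ω)
    (hmax : ∀ t i, density S t i ≤ ω) {t₀ m : ℤ} (hm : IsCrossing S M ω φ t₀ m) :
    IsEvolution (undressed S M ω φ) (M - ω) := by
  refine ⟨h.undressed_profile hω, fun t i => ?_⟩
  obtain ⟨s, hs⟩ := h.exists_crossing hmax hm i
  have before : ∀ {s'}, IsCrossing S M ω φ s' (i + 1) → t + 1 ≤ s → t + 1 ≤ s' →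
      min (1 - (UdKdV.undressed S M ω φ t (i + 1) - UdKdV.undressed S M ω φ t i)
        - (UdKdV.undressed S M ω φ (t + 1) (i + 1) - UdKdV.undressed S M ω φ (t + 1) i))
        (UdKdV.undressed S M ω φ t i - UdKdV.undressed S M ω φ (t + 1) (i + 1)) = 0 := by
    intro s' hs' h1 h2
    rw [undressed_of_le hmax hs (by omega), undressed_of_le hmax hs h1,
      undressed_of_le hmax hs' (by omega), undressed_of_le hmax hs' h2]
    have := h.step (t - 1) i
    rw [sub_add_cancel] at this
    rw [add_sub_cancel_right, ← this]
    congr 1 <;> ring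
  have after : ∀ {s'}, IsCrossing S M ω φ s' (i + 1) → s ≤ t → s' ≤ t →
      min (1 - (UdKdV.undressed S M ω φ t (i + 1) - UdKdV.undressed S M ω φ t i)
        - (UdKdV.undressed S M ω φ (t + 1) (i + 1) - UdKdV.undressed S M ω φ (t + 1) i))
        (UdKdV.undressed S M ω φ t i - UdKdV.undressed S M ω φ (t + 1) (i + 1)) = 0 := by
    intro s' hs' h1 h2
    rw [undressed_of_ge hmax hs h1, undressed_of_ge hmax hs (by omega),
      undressed_of_ge hmax hs' h2, undressed_of_ge hmax hs' (by omega)]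
    exact h.step (t + 1) i
  rcases h.crossing_succ hmax hs with hs' | hs'
  · rcases lt_or_ge t s with ht | ht
    · exact before hs' (by omega) (by omega)
    · exact after hs' ht ht
  · rcases lt_trichotomy t s with ht | rfl | ht
    · exact before hs' (by omega) (by omega)
    · rw [undressed_of_le hmax hs le_rfl, undressed_of_le hmax hs' (by omega),
        undressed_of_ge hmax hs (by omega), undressed_of_ge hmax hs' (by omega)]
      exact h.step_across_crossing hmax hs hs'
    · exact after hs' (by omega) (by omega)

theorem IsEvolution.undressed_density_le (h : IsEvolution S M)
    (hmax : ∀ t i, density S t i ≤ ω) {t₀ m : ℤ} (hm : IsCrossing S M ω φ t₀ m) (t i : ℤ) :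
    density (UdKdV.undressed S M ω φ) t i ≤ ω := by
  obtain ⟨s, hs⟩ := h.exists_crossing hmax hm i
  rcases lt_trichotomy t s with ht | rfl | ht
  · rw [density, undressed_of_le hmax hs (by omega), undressed_of_le hmax hs (by omega)]
    have := hmax (t - 1) i
    rw [density, sub_add_cancel] at this
    rw [add_sub_cancel_right]
    linarith
  -- Here the new density is the sum of the old ones at `t - 1` and `t + 1`, minus `ω`.
  · rw [density, undressed_of_le hmax hs (by omega), undressed_of_ge hmax hs (by omega)]
    have h1 := hmax (t - 1) i
    have h2 := hmax (t + 1) i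
    rw [density, sub_add_cancel] at h1
    rw [density, add_sub_cancel_right] at h2
    linarith
  · rw [density, undressed_of_ge hmax hs (by omega), undressed_of_ge hmax hs (by omega)]
    have := hmax (t + 1) i
    rw [density, add_sub_cancel_right] at this
    rwa [sub_add_cancel]

/-- At a fixed site, undressing excises two consecutive entries of positive sum from the sequence
of field values. -/
theorem IsEvolution.undressed_excision (h : IsEvolution S M) (hω : 0 < ω)
    (hmax : ∀ t i, density S t i ≤ ω) {t₀ m : ℤ} (hm : IsCrossing S M ω φ t₀ m) (i : ℤ) :
    ∃ s, 0 < field S s i + field S (s + 1) i ∧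
      (∀ t ≤ s, field (UdKdV.undressed S M ω φ) t i = field S (t - 1) i) ∧
      ∀ t > s, field (UdKdV.undressed S M ω φ) t i = field S (t + 1) i := by
  obtain ⟨s, hs⟩ := h.exists_crossing hmax hm i
  have hκ := waveNumber_pos hω
  refine ⟨s, ?_, ?_⟩
  · have e := mismatch_site_succ S M ω φ (s + 1) i
    rw [hs.2, add_sub_cancel_right] at e
    rcases h.crossing_succ hmax hs with hs' | hs'
    · rw [hs'.2] at e; linarith
    · rw [hs'.1] at e; linarith
  · rcases h.crossing_succ hmax hs with hs' | hs'
    all_goals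
      refine ⟨fun t ht => ?_, fun t ht => ?_⟩
      · rw [field, undressed_of_le hmax hs ht, undressed_of_le hmax hs' (by omega), field]
        ring
      · rw [field, undressed_of_ge hmax hs ht.le, undressed_of_ge hmax hs' (by omega), field]

/-! ### Termination -/

/-- The number of times at which a field is nonzero at the site `0`. -/
noncomputable def activity (U : ℤ → ℤ → ℝ) : ℕ := (Function.support fun t => U t 0).ncard

theorem IsEvolution.activity_undressed_lt (h : IsEvolution S M) (hω : 0 < ω)
    (hmax : ∀ t i, density S t i ≤ ω) {t₀ m : ℤ} (hm : IsCrossing S M ω φ t₀ m) :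
    activity (field (UdKdV.undressed S M ω φ)) < activity (field S) := by
  obtain ⟨s, hpos, hle, hgt⟩ := h.undressed_excision hω hmax hm 0
  -- The reindexing of surviving times, which skips exactly `s` and `s + 1`.
  let e : ℤ → ℤ := fun t => if t ≤ s then t - 1 else t + 1
  have he : Function.Injective e := by
    intro t t' htt
    simp only [e] at htt
    split_ifs at htt <;> omega
  have hval : ∀ t, field (UdKdV.undressed S M ω φ) t 0 = field S (e t) 0 := by
    intro t
    by_cases ht : t ≤ s
    · simp only [e, if_pos ht, hle t ht]
    · simp only [e, if_neg ht, hgt t (by omega)]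
  obtain ⟨r, hr, hre⟩ : ∃ r, field S r 0 ≠ 0 ∧ ∀ t, e t ≠ r := by
    by_cases h0 : field S s 0 = 0
    · refine ⟨s + 1, by rw [h0, zero_add] at hpos; exact hpos.ne', fun t ht => ?_⟩
      simp only [e] at ht
      split_ifs at ht <;> omega
    · refine ⟨s, h0, fun t ht => ?_⟩
      simp only [e] at ht
      split_ifs at ht <;> omega
  unfold activity
  rw [← Set.ncard_image_of_injective _ he]
  refine Set.ncard_lt_ncard ⟨?_, fun hsub => ?_⟩ (h.finite_times 0)
  · rintro _ ⟨t, ht, rfl⟩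
    rw [Function.mem_support, hval] at ht
    exact ht
  · obtain ⟨t, _, ht⟩ := hsub (show r ∈ Function.support fun t => field S t 0 from hr)
    exact hre t ht

/-! ### Dressing -/

/-- `T` is a `T`-function with time differences given by the cumulative states `S`. -/
def IsTau (S : ℤ → ℤ → ℝ) (M : ℝ) (T : ℤ → ℤ → ℝ) : Prop :=
  ∀ t i, T t i - T (t + 1) i = S t i - M / 2

/-- The difference of the two branches at time `t` is the mismatch at `t - 1` up to the crossing and
the mismatch at `t + 1` after it, so its sign selects the branch. -/
theorem IsTau.dress {T : ℤ → ℤ → ℝ} (h : IsEvolution S M)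
    (hmax : ∀ t i, density S t i ≤ ω) {t₀ m : ℤ} (hm : IsCrossing S M ω φ t₀ m)
    (hT : IsTau (UdKdV.undressed S M ω φ) (M - ω) T) : IsTau S M (dress ω φ T) := by
  intro t i
  obtain ⟨s, hs⟩ := h.exists_crossing hmax hm i
  have early : ∀ t ≤ s, UdKdV.dress ω φ T t i
      = 1 / 2 * waveNumber ω * (i - phaseAt ω φ t) + T (t + 1) i := by
    intro t ht
    have h1 := hT t i
    have h2 := hT (t - 1) i
    rw [undressed_of_le hmax hs ht] at h1
    rw [undressed_of_le hmax hs (by omega), sub_add_cancel] at h2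
    have h3 := mismatch_nonneg hmax hs (t := t - 1) (by omega)
    have h4 := mismatch_time_succ S M ω φ (t - 1) i
    rw [sub_add_cancel, density, sub_add_cancel, mismatch] at h4
    refine max_eq_left ?_
    linarith
  have late : ∀ t > s, UdKdV.dress ω φ T t i
      = -(1 / 2 * waveNumber ω * (i - phaseAt ω φ t)) + T (t - 1) i := by
    intro t ht
    have h1 := hT t i
    have h2 := hT (t - 1) i
    rw [undressed_of_ge hmax hs ht.le] at h1
    rw [undressed_of_ge hmax hs (by omega), sub_add_cancel] at h2
    have h3 := mismatch_nonpos hmax hs (t := t + 1) (by omega)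
    rw [mismatch_time_succ, density, mismatch] at h3
    refine max_eq_right ?_
    linarith
  have hp : waveNumber ω * phaseAt ω φ (t + 1) = waveNumber ω * phaseAt ω φ t + ω := by
    have := waveNumber_mul_speed ω
    simp only [phaseAt]
    push_cast
    linear_combination this
  rcases lt_trichotomy t s with ht | rfl | ht
  · rw [early t ht.le, early (t + 1) (by omega)]
    have h1 := hT (t + 1) i
    rw [undressed_of_le hmax hs (by omega), add_sub_cancel_right] at h1
    linear_combination h1 + 1 / 2 * hp
  · rw [early t le_rfl, late (t + 1) (by omega), add_sub_cancel_right]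
    have h1 := hT t i
    rw [undressed_of_le hmax hs le_rfl] at h1
    have h2 := hs.1
    rw [mismatch] at h2
    linear_combination -h1 - 1 / 2 * hp + h2
  · rw [late t ht, late (t + 1) (by omega), add_sub_cancel_right]
    have h1 := hT (t - 1) i
    rw [undressed_of_ge hmax hs (by omega), sub_add_cancel] at h1
    linear_combination h1 - 1 / 2 * hp

theorem IsTau.potential_eq {T : ℤ → ℤ → ℝ} (hT : IsTau S M T) : potential T = field S := by
  funext t i
  rw [potential, field]
  linear_combination hT t (i + 1) - hT t i

/-- In time differences of `T` the equation is the update rule from `t - 1` to `t`; the constants `M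
/ 2` cancel. -/
theorem IsTau.isBilinearSolution {T : ℤ → ℤ → ℝ} (h : IsEvolution S M) (hT : IsTau S M T) :
    IsBilinearSolution T := by
  intro t i
  have h1 := h.step (t - 1) i
  have e1 := hT (t - 1) i
  have e2 := hT (t - 1) (i + 1)
  have e3 := hT t i
  have e4 := hT t (i + 1)
  simp only [sub_add_cancel] at *
  rcases min_cases (1 - (S (t - 1) (i + 1) - S (t - 1) i) - (S t (i + 1) - S t i))
    (S (t - 1) i - S t (i + 1)) with h2 | h2
  · rw [max_eq_right] <;> linarith
  · rw [max_eq_left] <;> linarith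

end Crossing

/-! ### Backgrounds -/

/-- The increment of `|n - j|` in `n` is `+1` for `j < n` and `-1` for `j ≥ n`. -/
theorem sum_abs_sub_sum_abs {B : ℤ → ℝ} {M : ℝ} {g : ℤ → ℝ} (hg : IsProfile M g)
    (hB : ∀ i, B i = g (i + 1) - g i) (n : ℤ) :
    (∑ᶠ j, |((n - j : ℤ) : ℝ)| * B j) - ∑ᶠ j, |((n - 1 - j : ℤ) : ℝ)| * B j = 2 * g n - M := by
  have hf := hg.finiteSupport hB
  have hmul : ∀ c : ℤ → ℝ, (Function.support fun j => c j * B j).Finite := fun c =>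
    hf.subset fun j hj => right_ne_zero_of_mul hj
  rw [← finsum_sub_distrib (hmul _) (hmul _)]
  have h1 : (∑ᶠ j, (Set.Iio n).indicator B j) = g n := by
    rw [← finsum_mem_def, hg.finsum_Iio hB]
  have h2 : (∑ᶠ j, (Set.Ici n).indicator B j) = M - g n := by
    rw [← finsum_mem_def, hg.finsum_Ici hB]
  have key : ∀ j, |((n - j : ℤ) : ℝ)| * B j - |((n - 1 - j : ℤ) : ℝ)| * B j
      = (Set.Iio n).indicator B j - (Set.Ici n).indicator B j := by
    intro j
    rcases lt_or_ge j n with hj | hj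
    · rw [Set.indicator_of_mem (show j ∈ Set.Iio n from hj),
        Set.indicator_of_notMem (by simpa using hj)]
      have : (j : ℝ) + 1 ≤ n := by exact_mod_cast hj
      rw [abs_of_nonneg (by push_cast; linarith), abs_of_nonneg (by push_cast; linarith)]
      push_cast
      ring
    · rw [Set.indicator_of_notMem (by simpa using hj),
        Set.indicator_of_mem (show j ∈ Set.Ici n from hj)]
      have : (n : ℝ) ≤ j := by exact_mod_cast hj
      rw [abs_of_nonpos (by push_cast; linarith), abs_of_nonpos (by push_cast; linarith)]
      push_cast
      ring
  have hind : ∀ s : Set ℤ, (Function.support (s.indicator B)).Finite := fun s =>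
    hf.subset (by rw [Set.support_indicator]; exact Set.inter_subset_right)
  rw [finsum_congr key, finsum_sub_distrib (hind _) (hind _), h1, h2]
  ring

/-- Translation at speed one makes the second argument of the minimum vanish identically, and `V =
0` keeps the first at least 1; by uniqueness this is the evolution. -/
theorem IsBackground.isTau {B : ℤ → ℝ} (hB : IsBackground B) {S : ℤ → ℤ → ℝ} {M : ℝ}
    (h : IsEvolution S M) (h0 : field S 0 = B) : IsTau S M (backgroundT B) := by
  obtain ⟨hf, hV⟩ := hB
  obtain ⟨M', g, hg, hu⟩ := hf.exists_profile
  have hE : IsEvolution (fun t i => g (i - t)) M' := by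
    refine ⟨fun t => ?_, fun t i => ?_⟩
    · obtain ⟨⟨a, ha⟩, b, hb⟩ := hg
      exact ⟨⟨a + t, fun i hi => ha _ (by omega)⟩, b + t, fun i hi => hb _ (by omega)⟩
    · have h1 := hf.local_sum_le (i - t - 1)
      rw [hV, hu, hu, sub_add_cancel] at h1
      simp only [show i + 1 - t = i - t + 1 by ring, show i + 1 - (t + 1) = i - t by ring,
        show i - (t + 1) = i - t - 1 by ring, sub_self]
      exact min_eq_right (by linarith)
  obtain ⟨rfl, rfl⟩ := h.unique hE (by
    rw [h0]
    funext i
    simp only [field, sub_zero, hu])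
  intro t i
  have := sum_abs_sub_sum_abs hg hu (i - t)
  simp only [backgroundT, show ∀ j, i - (t + 1) - j = i - t - 1 - j from fun j => by ring]
  linear_combination 1 / 2 * this

/-! ### Complete undressings -/

/-- The phase constant is the value of `φ` for which the mismatch vanishes at time 0 and site `m`;
as the density there is `ω`, this is a crossing. -/
theorem IsEvolution.isUndressing_data {S : ℤ → ℤ → ℝ} {M ω φ : ℝ} {u' : ℤ → ℝ}
    (h : IsEvolution S M) (hu : IsUndressing (field S 0) ω φ u') :
    0 < ω ∧ ω = maxMass (field S) 0 ∧ (∀ t i, density S t i ≤ ω) ∧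
      (∃ m, IsCrossing S M ω φ 0 m) ∧ u' = field (UdKdV.undressed S M ω φ) 0 := by
  obtain ⟨U, hU, hU0, hV, hω, m, hm, hφ, rfl⟩ := hu
  obtain ⟨S', M', hS', rfl⟩ := hU.exists_evolution
  obtain ⟨rfl, rfl⟩ := hS'.unique h hU0
  have hpos : 0 < ω := hω ▸ hV.trans_le h.maximalLocalSum_le_maxMass
  refine ⟨hpos, hω, h.density_le hpos fun i => hω ▸ h.density_le_maxMass 0 i, ⟨m, ?_⟩,
    by rw [h.darboux_eq]⟩
  rw [h.X_field] at hm
  refine isCrossing_iff.2 ⟨?_, hm⟩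
  have hκ := (waveNumber_pos hpos).ne'
  rw [mismatch, hφ, phaseAt, phaseConstant,
    (h.profile (0 - 1)).finsum_Ici (u := field _ (0 - 1)) (fun _ => rfl),
    (h.profile 0).finsum_Iio (u := field _ 0) (fun _ => rfl)]
  field_simp
  push_cast
  ring

theorem IsEvolution.exists_isUndressing {S : ℤ → ℤ → ℝ} {M : ℝ} (h : IsEvolution S M)
    (hV : 0 < maximalLocalSum (field S 0)) : ∃ ω φ u', IsUndressing (field S 0) ω φ u' := by
  obtain ⟨m, hm⟩ := h.exists_density_eq_maxMass 0
  exact ⟨_, _, _, field S, h.isSolution, rfl, hV, rfl, m, by rw [h.X_field, hm], rfl, rfl⟩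

theorem IsEvolution.exists_completeUndressing {S : ℤ → ℤ → ℝ} {M : ℝ} (h : IsEvolution S M) :
    ∃ L B, CompleteUndressing (field S 0) L B := by
  induction hn : activity (field S) using Nat.strong_induction_on generalizing S M with
  | _ n ih =>
    have hf := h.isSolution.1 0
    rcases hf.maximalLocalSum_nonneg.eq_or_lt with hV | hV
    · exact ⟨[], _, .done _ ⟨hf, hV.symm⟩⟩
    · obtain ⟨ω, φ, u', hu⟩ := h.exists_isUndressing hV
      obtain ⟨hω, -, hmax, ⟨m, hm⟩, rfl⟩ := h.isUndressing_data hu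
      obtain ⟨L, B, hL⟩ := ih _ (hn ▸ h.activity_undressed_lt hω hmax hm)
        (h.undressed hω hmax hm) rfl
      exact ⟨_, _, .step _ _ _ _ _ _ hu hL⟩

theorem IsEvolution.no_infinite_undressing {S : ℤ → ℤ → ℝ} {M : ℝ} (h : IsEvolution S M)
    (s : ℕ → ℤ → ℝ) (h0 : s 0 = field S 0)
    (hs : ∀ n, ∃ ω φ : ℝ, IsUndressing (s n) ω φ (s (n + 1))) : False := by
  induction hn : activity (field S) using Nat.strong_induction_on generalizing S M s with
  | _ n ih =>
    obtain ⟨ω, φ, hu⟩ := hs 0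
    rw [h0] at hu
    obtain ⟨hω, -, hmax, ⟨m, hm⟩, h1⟩ := h.isUndressing_data hu
    exact ih _ (hn ▸ h.activity_undressed_lt hω hmax hm) (h.undressed hω hmax hm)
      (fun n => s (n + 1)) h1 (fun n => hs (n + 1)) rfl

/-- The bound by the maximal mass strengthens the induction: undressing cannot raise that mass, so
the recorded masses come out in order. -/
theorem CompleteUndressing.isTau {u B : ℤ → ℝ} {L : List (ℝ × ℝ)}
    (hL : CompleteUndressing u L B) {S : ℤ → ℤ → ℝ} {M : ℝ} (h : IsEvolution S M)
    (h0 : field S 0 = u) :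
    (∀ p ∈ L, 0 < p.1 ∧ p.1 ≤ maxMass (field S) 0) ∧ L.Pairwise (fun p q => q.1 ≤ p.1) ∧
      IsTau S M (reconstructedT L B) := by
  induction hL generalizing S M with
  | done B hB => exact ⟨by simp, List.Pairwise.nil, hB.isTau h h0⟩
  | step u u' ω φ L B hu _ ih =>
    subst h0
    obtain ⟨hω, hω', hmax, ⟨m, hm⟩, h1⟩ := h.isUndressing_data hu
    have hE := h.undressed hω hmax hm
    obtain ⟨i1, i2, i3⟩ := ih hE h1.symm
    have hle : maxMass (field (UdKdV.undressed S M ω φ)) 0 ≤ ω := by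
      obtain ⟨i, hi⟩ := hE.exists_density_eq_maxMass 0
      exact hi ▸ h.undressed_density_le hmax hm 0 i
    refine ⟨?_, List.pairwise_cons.2 ⟨fun q hq => (i1 q hq).2.trans hle, i2⟩,
      IsTau.dress h hmax hm i3⟩
    rintro p hp
    rcases List.mem_cons.1 hp with rfl | hp
    · exact ⟨hω, hω'.le⟩
    · exact ⟨(i1 p hp).1, ((i1 p hp).2.trans hle).trans hω'.le⟩

end UdKdV

theorem mainTheorem1 (u : ℤ → ℝ) (hu : UdKdV.FiniteSupport u) :
    (∃ (L : List (ℝ × ℝ)) (B : ℤ → ℝ), UdKdV.CompleteUndressing u L B) ∧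
    (¬ ∃ s : ℕ → ℤ → ℝ, s 0 = u ∧ ∀ n, ∃ ω φ : ℝ, UdKdV.IsUndressing (s n) ω φ (s (n + 1))) ∧
    ∀ (L : List (ℝ × ℝ)) (B : ℤ → ℝ), UdKdV.CompleteUndressing u L B →
      (∀ p ∈ L, 0 < p.1) ∧
      L.Pairwise (fun p q => q.1 ≤ p.1) ∧
      UdKdV.IsBilinearSolution (UdKdV.reconstructedT L B) ∧
      UdKdV.IsSolution (UdKdV.potential (UdKdV.reconstructedT L B)) ∧
      UdKdV.potential (UdKdV.reconstructedT L B) 0 = u := by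
  obtain ⟨M, g, hg, hgu⟩ := hu.exists_profile
  obtain ⟨S, h, rfl⟩ := hg.exists_evolution
  obtain rfl : UdKdV.field S 0 = u := funext fun i => (hgu i).symm
  refine ⟨h.exists_completeUndressing, fun ⟨s, hs0, hs⟩ => h.no_infinite_undressing s hs0 hs,
    fun L B hL => ?_⟩
  obtain ⟨h1, h2, h3⟩ := hL.isTau h rfl
  refine ⟨fun p hp => (h1 p hp).1, h2, h3.isBilinearSolution h, ?_, ?_⟩
  · rw [h3.potential_eq]
    exact h.isSolution
  · rw [h3.potential_eq]
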